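/- Let $L_1,L_2,c_\eta,c_\mu>0$. There is a constant $C>0$, depending only on $L_1,L_2,c_\eta,c_\mu$, such that the following holds for all integers $d,q,T\ge 1$. Let $f:\mathbb R^d\to\mathbb R$ (the attack loss) be $L_1$-Lipschitz and differentiable with $L_2$-Lipschitz gradient (Euclidean norm). Let $P$ denote the coordinatewise clipping (projection) onto $[0,1]^d$. Let $a_0\in[0,1]^d$, let $0<\eta_t\le c_\eta/\sqrt T$ for $0\le t<T$, and let $0<\mu\le c_\mu/\sqrt{dq}$. Let $u_{t,j}$ ($0\le t<T$, $1\le j\le q$) be independent random vectors, uniformly distributed on the Euclidean unit sphere of $\mathbb R^d$, and define $$\hat\nabla f(a_t)=\frac dq\sum_{j=1}^q\frac{f(a_t+\mu u_{t,j})-f(a_t-\mu u_{t,j})}{2\mu}\,u_{t,j},\qquad a_{t+1}=P\big[a_t-\eta_t\hat\nabla f(a_t)\big].$$ Let $r$ be a random index in $\{0,\dots,T-1\}$, independent of all the $u_{t,j}$, with $$\mathbb P(r=t)=\frac{2\eta_t-L_2\eta_t^2}{\sum_{s=0}^{T-1}(2\eta_s-L_2\eta_s^2)}$$ (the step sizes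 being such that these numbers form a probability distribution, for instance $\eta_t<1/L_2$ for all $t$). Let $G_t=\frac1{\eta_t}\big(a_t-P[a_t-\eta_t\hat\nabla f(a_t)]\big)$ be the rectified gradient. Then $\|G_r\|^2$ is integrable and $$\mathbb E\big[\|G_r\|^2\big]\le C\Big(\frac1{\sqrt T}+\frac{d+q}{q}\Big).$$ -/

import Mathlib

open MeasureTheory ProbabilityTheory
open scoped NNReal Gradient

noncomputable section

/-- The Euclidean unit sphere of `ℝ^d`. -/
abbrev UnitSphere (d : ℕ) : Type := Metric.sphere (0 : EuclideanSpace ℝ (Fin d)) 1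

/-- The uniform distribution on the unit sphere of `ℝ^d`: normalized surface measure. -/
def uniformSphere (d : ℕ) : Measure (UnitSphere d) :=
  ((volume : Measure (EuclideanSpace ℝ (Fin d))).toSphere Set.univ)⁻¹ •
    (volume : Measure (EuclideanSpace ℝ (Fin d))).toSphere

/-- The unit cube `[0,1]^d`. -/
def unitCube (d : ℕ) : Set (EuclideanSpace ℝ (Fin d)) :=
  {x | ∀ i, 0 ≤ x i ∧ x i ≤ 1}

/-- The projection onto `[0,1]^d`, which clips each coordinate to `[0,1]`. -/
def proj01 {d : ℕ} (x : EuclideanSpace ℝ (Fin d)) : EuclideanSpace ℝ (Fin d) :=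
  WithLp.toLp 2 fun i => if x i < 0 then 0 else if 1 < x i then 1 else x i

/-- The zeroth-order gradient estimate of `f` at `a` from the directions `u 1, …, u q`:
`(d / q) * ∑ j, (f (a + μ u_j) - f (a - μ u_j)) / (2 μ) * u_j`. -/
def gradEst {d q : ℕ} (f : EuclideanSpace ℝ (Fin d) → ℝ) (μ : ℝ)
    (u : Fin q → UnitSphere d) (a : EuclideanSpace ℝ (Fin d)) : EuclideanSpace ℝ (Fin d) :=
  ((d : ℝ) / (q : ℝ)) •
    ∑ j, ((f (a + μ • (u j : EuclideanSpace ℝ (Fin d))) -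
        f (a - μ • (u j : EuclideanSpace ℝ (Fin d)))) / (2 * μ)) •
      (u j : EuclideanSpace ℝ (Fin d))

/-- The rectified (projected) gradient `(1/η) (a - P[a - η g])`. -/
def rectGrad {d : ℕ} (a g : EuclideanSpace ℝ (Fin d)) (η : ℝ) : EuclideanSpace ℝ (Fin d) :=
  (1 / η) • (a - proj01 (a - η • g))

/-- The iterates of zeroth-order projected gradient descent started at `a₀`, with step sizes
`η t`, smoothing radius `μ` and the directions `u t j` used in iteration `t`. -/
def zoIterate {d q : ℕ} (f : EuclideanSpace ℝ (Fin d) → ℝ) (μ : ℝ) (η : ℕ → ℝ)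
    (a₀ : EuclideanSpace ℝ (Fin d)) (u : ℕ → Fin q → UnitSphere d) :
    ℕ → EuclideanSpace ℝ (Fin d)
  | 0 => a₀
  | t + 1 =>
      proj01 (zoIterate f μ η a₀ u t - η t • gradEst f μ (u t) (zoIterate f μ η a₀ u t))

/-- The rectified gradient at the `t`-th iterate, with the gradient estimate that the algorithm
computes in iteration `t`. -/
def zoRectGrad {d q : ℕ} (f : EuclideanSpace ℝ (Fin d) → ℝ) (μ : ℝ) (η : ℕ → ℝ)
    (a₀ : EuclideanSpace ℝ (Fin d)) (u : ℕ → Fin q → UnitSphere d) (t : ℕ) :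
    EuclideanSpace ℝ (Fin d) :=
  rectGrad (zoIterate f μ η a₀ u t) (gradEst f μ (u t) (zoIterate f μ η a₀ u t)) (η t)

/-- The unnormalized weight `2 η - L₂ η²` of an iterate. -/
def stepWeight (L₂ η : ℝ) : ℝ := 2 * η - L₂ * η ^ 2

end

/-!
The right-hand side contains the term `(d + q) / q`, which already bounds the second moment of the
gradient estimate, so no descent argument is needed.

At a point of the cube the projection is nonexpansive and fixes the point, hence
`‖G_t‖ ≤ ‖gradEst‖` (`norm_rectGrad_le`). By the mean value inequality each symmetric difference
quotient is `⟪∇ f a, u j⟫` up to an error of size `L₂ μ`. After multiplication by `d` this bias has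
square at most `(d L₂ μ)² ≤ L₂² cμ² d / q`, whatever the directions are (`norm_gradEst_sq_le`). The
remaining unbiased part is an average of `q` independent vectors `d ⟪g, u⟫ u` with mean `g` and
second moment `d ‖g‖²`, so its second moment is `‖g‖² (d + q - 1) / q`
(`integral_norm_sq_sum_inner_smul`); this rests on the identity
`∫ ⟪x, u⟫ ⟪y, u⟫ = ⟪x, y⟫ / d` for the uniform law on the sphere, which follows from rotation
invariance (`integral_inner_mul_inner`).

The iterate `a_t` depends only on earlier directions, so the bound at a fixed point holds at `a_t`
(`integral_norm_gradEst_zoIterate_sq_le`). The random index is independent of the directions, so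
`𝔼 ‖G_r‖²` is an average of the `𝔼 ‖G_t‖²` (`integral_comp_random_index`). Only the fact that the
weights sum to one matters, and this is automatic as they are the law of `r`.
-/

/-! ### Moments of the uniform distribution on the sphere -/

instance isProbabilityMeasure_uniformSphere {d : ℕ} [NeZero d] :
    IsProbabilityMeasure (uniformSphere d) := by
  refine ⟨?_⟩
  have : Nontrivial (EuclideanSpace ℝ (Fin d)) :=
    Module.nontrivial_of_finrank_pos (R := ℝ) (by simpa using NeZero.pos d)
  rw [uniformSphere, Measure.smul_apply, smul_eq_mul]
  refine ENNReal.inv_mul_cancel ?_ (measure_ne_top _ _)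
  rw [Ne, Measure.measure_univ_eq_zero]
  exact Measure.toSphere_ne_zero _

/-- The action of a linear isometry of `ℝ^d` on the unit sphere. -/
noncomputable def sphereMap {d : ℕ} (φ : EuclideanSpace ℝ (Fin d) ≃ₗᵢ[ℝ] EuclideanSpace ℝ (Fin d))
    (u : UnitSphere d) : UnitSphere d :=
  ⟨φ u, by simp⟩

open scoped Pointwise in
lemma measurePreserving_sphereMap {d : ℕ}
    (φ : EuclideanSpace ℝ (Fin d) ≃ₗᵢ[ℝ] EuclideanSpace ℝ (Fin d)) :
    MeasurePreserving (sphereMap φ) (uniformSphere d) (uniformSphere d) := by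
  have hmeas : Measurable (sphereMap φ) :=
    (Continuous.subtype_mk (φ.continuous.comp continuous_subtype_val) _).measurable
  have key : MeasurePreserving (sphereMap φ)
      (volume : Measure (EuclideanSpace ℝ (Fin d))).toSphere
      (volume : Measure (EuclideanSpace ℝ (Fin d))).toSphere := by
    refine ⟨hmeas, Measure.ext fun s hs => ?_⟩
    rw [Measure.map_apply hmeas hs, Measure.toSphere_apply' _ (hmeas hs),
      Measure.toSphere_apply' _ hs]
    congr 1
    -- the cone over the preimage of `s` is the preimage of the cone over `s`
    rw [← φ.measurePreserving.measure_preimage_equiv (f := φ.toMeasurableEquiv)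
      (Set.Ioo (0 : ℝ) 1 • (Subtype.val '' s))]
    congr 1
    ext x
    simp only [Set.mem_smul, Set.mem_image, Set.mem_preimage]
    constructor
    · rintro ⟨c, hc, _, ⟨v, hv, rfl⟩, rfl⟩
      exact ⟨c, hc, _, ⟨sphereMap φ v, hv, rfl⟩, (φ.map_smul c _).symm⟩
    · rintro ⟨c, hc, _, ⟨v, hv, rfl⟩, h : c • (v : EuclideanSpace ℝ (Fin d)) = φ x⟩
      refine ⟨c, hc, _, ⟨sphereMap φ.symm v, ?_, rfl⟩, ?_⟩
      · have : sphereMap φ (sphereMap φ.symm v) = v := Subtype.ext (φ.apply_symm_apply _)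
        rwa [this]
      · change c • φ.symm (v : EuclideanSpace ℝ (Fin d)) = x
        rw [← map_smul, h]
        exact φ.symm_apply_apply x
  exact key.smul_measure _

lemma integrable_of_continuous_of_compactSpace {X : Type*} [TopologicalSpace X] [CompactSpace X]
    [MeasurableSpace X] [OpensMeasurableSpace X] {ν : Measure X} [IsFiniteMeasure ν] {F : X → ℝ}
    (hF : Continuous F) : Integrable F ν :=
  hF.integrable_of_hasCompactSupport (HasCompactSupport.of_compactSpace F)

lemma integral_inner_sq_congr {d : ℕ} {x y : EuclideanSpace ℝ (Fin d)} (h : ‖x‖ = ‖y‖) :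
    ∫ u, (inner ℝ x (u : EuclideanSpace ℝ (Fin d))) ^ 2 ∂uniformSphere d =
      ∫ u, (inner ℝ y (u : EuclideanSpace ℝ (Fin d))) ^ 2 ∂uniformSphere d := by
  set φ := (Submodule.span ℝ {x - y})ᗮ.reflection with hφ
  have hxy : φ x = y := Submodule.reflection_sub h
  have hmp := measurePreserving_sphereMap φ
  have hc : Continuous fun u : UnitSphere d =>
      (inner ℝ y (u : EuclideanSpace ℝ (Fin d))) ^ 2 := by fun_prop
  rw [← hmp.map_eq, integral_map hmp.measurable.aemeasurable hc.aestronglyMeasurable, hmp.map_eq]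
  simp only [sphereMap, ← hxy, LinearIsometryEquiv.inner_map_map]

/-- By rotation invariance the second moment depends only on `‖x‖`, and its values at an
orthonormal basis sum to `1`. -/
lemma integral_inner_sq {d : ℕ} [NeZero d] (x : EuclideanSpace ℝ (Fin d)) :
    ∫ u, (inner ℝ x (u : EuclideanSpace ℝ (Fin d))) ^ 2 ∂uniformSphere d = ‖x‖ ^ 2 / d := by
  let b := EuclideanSpace.basisFun (Fin d) ℝ
  have hd : (d : ℝ) ≠ 0 := NeZero.ne _
  have hi : ∀ i, ∫ u, (inner ℝ (b i) (u : EuclideanSpace ℝ (Fin d))) ^ 2 ∂uniformSphere d =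
      ∫ u, (inner ℝ (b 0) (u : EuclideanSpace ℝ (Fin d))) ^ 2 ∂uniformSphere d :=
    fun i => integral_inner_sq_congr (by rw [b.norm_eq_one, b.norm_eq_one])
  have hsum : ∑ i, ∫ u, (inner ℝ (b i) (u : EuclideanSpace ℝ (Fin d))) ^ 2 ∂uniformSphere d
      = 1 := by
    rw [← integral_finsetSum _ fun i _ => integrable_of_continuous_of_compactSpace (by fun_prop)]
    have : ∀ u : UnitSphere d,
        ∑ i, (inner ℝ (b i) (u : EuclideanSpace ℝ (Fin d))) ^ 2 = 1 := fun u => by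
      have := b.sum_sq_norm_inner_right (u : EuclideanSpace ℝ (Fin d))
      simpa using this
    simp [this]
  rw [Finset.sum_congr rfl fun i _ => hi i] at hsum
  simp only [Finset.sum_const, Finset.card_univ, Fintype.card_fin, nsmul_eq_mul] at hsum
  rw [integral_inner_sq_congr (y := ‖x‖ • b 0) (by simp [norm_smul])]
  simp only [real_inner_smul_left, mul_pow, integral_const_mul]
  field_simp
  linear_combination ‖x‖ ^ 2 * hsum

lemma integral_inner_mul_inner {d : ℕ} [NeZero d] (x y : EuclideanSpace ℝ (Fin d)) :
    ∫ u, inner ℝ x (u : EuclideanSpace ℝ (Fin d)) * inner ℝ y (u : EuclideanSpace ℝ (Fin d))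
      ∂uniformSphere d = inner ℝ x y / d := by
  have h : ∀ u : UnitSphere d,
      inner ℝ x (u : EuclideanSpace ℝ (Fin d)) * inner ℝ y (u : EuclideanSpace ℝ (Fin d)) =
        ((inner ℝ (x + y) (u : EuclideanSpace ℝ (Fin d))) ^ 2 -
          (inner ℝ (x - y) (u : EuclideanSpace ℝ (Fin d))) ^ 2) / 4 := fun u => by
    rw [inner_add_left, inner_sub_left]; ring
  simp only [h]
  rw [integral_div, integral_sub (integrable_of_continuous_of_compactSpace (by fun_prop))
    (integrable_of_continuous_of_compactSpace (by fun_prop)), integral_inner_sq, integral_inner_sq,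
    @norm_add_sq_real, @norm_sub_sq_real]
  ring

/-- For independent uniform directions `u j`, the vectors `d ⟪g, u j⟫ u j` are independent with
mean `g` and second moment `d ‖g‖²`; this is the resulting second moment of their average. -/
lemma integral_norm_sq_sum_inner_smul {d q : ℕ} [NeZero d] [NeZero q]
    (g : EuclideanSpace ℝ (Fin d)) :
    ∫ u : Fin q → UnitSphere d, ‖((d : ℝ) / q) •
        ∑ j, inner ℝ g (u j : EuclideanSpace ℝ (Fin d)) • (u j : EuclideanSpace ℝ (Fin d))‖ ^ 2
      ∂Measure.pi (fun _ => uniformSphere d) = ‖g‖ ^ 2 * ((d + q - 1) / q) := by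
  have hd : (d : ℝ) ≠ 0 := NeZero.ne _
  have hq : (q : ℝ) ≠ 0 := NeZero.ne _
  let π : Measure (Fin q → UnitSphere d) := Measure.pi fun _ => uniformSphere d
  let F : UnitSphere d → UnitSphere d → ℝ := fun v w =>
    inner ℝ g (v : EuclideanSpace ℝ (Fin d)) *
      (inner ℝ g (w : EuclideanSpace ℝ (Fin d)) *
        inner ℝ (v : EuclideanSpace ℝ (Fin d)) (w : EuclideanSpace ℝ (Fin d)))
  have hFc : Continuous (Function.uncurry F) := by
    unfold F Function.uncurry; fun_prop
  have hexp : ∀ u : Fin q → UnitSphere d, ‖((d : ℝ) / q) •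
        ∑ j, inner ℝ g (u j : EuclideanSpace ℝ (Fin d)) • (u j : EuclideanSpace ℝ (Fin d))‖ ^ 2 =
      ((d : ℝ) / q) ^ 2 * ∑ j, ∑ k, F (u j) (u k) := fun u => by
    rw [norm_smul, mul_pow, Real.norm_eq_abs, sq_abs, ← real_inner_self_eq_norm_sq, sum_inner]
    simp only [inner_sum, real_inner_smul_left, real_inner_smul_right, F]
    congr 1
    refine Finset.sum_congr rfl fun j _ => Finset.sum_congr rfl fun k _ => ?_
    rw [mul_left_comm]
  have hint : ∀ j k, Integrable (fun u : Fin q → UnitSphere d => F (u j) (u k)) π := fun j k => by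
    have : Continuous fun u : Fin q → UnitSphere d => F (u j) (u k) := by
      unfold F; fun_prop
    exact integrable_of_continuous_of_compactSpace this
  have hval : ∀ j k, ∫ u, F (u j) (u k) ∂π =
      if j = k then ‖g‖ ^ 2 / d else ‖g‖ ^ 2 / d ^ 2 := by
    intro j k
    split_ifs with hjk
    · subst hjk
      have h1 : ∀ v, F v v = (inner ℝ g (v : EuclideanSpace ℝ (Fin d))) ^ 2 := fun v => by
        simp [F, pow_two]
      simp only [h1]
      rw [← integral_inner_sq g, ← (measurePreserving_eval (fun _ => uniformSphere d) j).map_eq,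
        integral_map (measurable_pi_apply j).aemeasurable (by fun_prop)]
    · have hind := (iIndepFun_pi (μ := fun _ : Fin q => uniformSphere d)
        (X := fun _ => id) fun _ => aemeasurable_id).indepFun hjk
      have hlaw := hind.map_prod_eq_prod_map_map
        (measurable_pi_apply j).aemeasurable (measurable_pi_apply k).aemeasurable
      have hj := (measurePreserving_eval (fun _ : Fin q => uniformSphere d) j).map_eq
      have hk := (measurePreserving_eval (fun _ : Fin q => uniformSphere d) k).map_eq
      have hlaw' : Measure.map (fun u => (u j, u k)) π =
          (uniformSphere d).prod (uniformSphere d) := by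
        refine hlaw.trans ?_
        congr 1
      have e1 : ∫ u, F (u j) (u k) ∂π =
          ∫ p, Function.uncurry F p ∂(uniformSphere d).prod (uniformSphere d) := by
        rw [← hlaw', integral_map (by fun_prop) hFc.aestronglyMeasurable]
        rfl
      rw [e1, integral_prod]
      · simp only [Function.uncurry, F, integral_const_mul, integral_inner_mul_inner]
        have : ∀ v : UnitSphere d, inner ℝ g (v : EuclideanSpace ℝ (Fin d)) *
            (inner ℝ g (v : EuclideanSpace ℝ (Fin d)) / d) =
              (inner ℝ g (v : EuclideanSpace ℝ (Fin d))) ^ 2 / d := fun v => by ring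
        simp only [this, integral_div, integral_inner_sq]
        field_simp
      · exact integrable_of_continuous_of_compactSpace hFc
  simp only [hexp]
  rw [integral_const_mul, integral_finsetSum _ fun j _ => integrable_finsetSum _ fun k _ => hint j k]
  simp only [integral_finsetSum _ fun k _ => hint _ k, hval, Finset.sum_ite, Finset.sum_const,
    Finset.filter_eq, Finset.filter_ne, Finset.mem_univ, if_true, Finset.card_singleton,
    Finset.card_erase_of_mem, Finset.card_univ, Fintype.card_fin, nsmul_eq_mul,
    Nat.cast_pred (NeZero.pos q), Nat.cast_one]
  field_simp
  ring

/-! ### Clipping to the cube -/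

lemma proj01_apply {d : ℕ} (x : EuclideanSpace ℝ (Fin d)) (i : Fin d) :
    proj01 x i = max 0 (min 1 (x i)) := by
  simp only [proj01]
  split_ifs with h0 h1
  · rw [min_eq_right (by linarith), max_eq_left h0.le]
  · rw [min_eq_left h1.le, max_eq_right zero_le_one]
  · rw [min_eq_right (not_lt.1 h1), max_eq_right (not_lt.1 h0)]

lemma proj01_mem_unitCube {d : ℕ} (x : EuclideanSpace ℝ (Fin d)) : proj01 x ∈ unitCube d :=
  fun i => by simp [proj01_apply]

lemma proj01_eq_self {d : ℕ} {x : EuclideanSpace ℝ (Fin d)} (hx : x ∈ unitCube d) :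
    proj01 x = x := by
  ext i
  rw [proj01_apply, min_eq_right (hx i).2, max_eq_right (hx i).1]

lemma lipschitzWith_proj01 {d : ℕ} : LipschitzWith 1 (proj01 (d := d)) := by
  refine LipschitzWith.of_dist_le_mul fun x y => ?_
  rw [NNReal.coe_one, one_mul, EuclideanSpace.dist_eq, EuclideanSpace.dist_eq]
  refine Real.sqrt_le_sqrt (Finset.sum_le_sum fun i _ => ?_)
  refine pow_le_pow_left₀ dist_nonneg ?_ 2
  rw [proj01_apply, proj01_apply, Real.dist_eq, Real.dist_eq]
  refine (abs_max_sub_max_le_max _ _ _ _).trans ?_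
  rw [sub_self, abs_zero, max_eq_right (abs_nonneg _)]
  refine (abs_min_sub_min_le_max _ _ _ _).trans ?_
  rw [sub_self, abs_zero, max_eq_right (abs_nonneg _)]

/-- Since the projection is nonexpansive and fixes `a`, rectifying does not increase the norm. -/
lemma norm_rectGrad_le {d : ℕ} {a : EuclideanSpace ℝ (Fin d)} (ha : a ∈ unitCube d)
    (g : EuclideanSpace ℝ (Fin d)) {η : ℝ} (hη : 0 < η) : ‖rectGrad a g η‖ ≤ ‖g‖ := by
  have h : ‖a - proj01 (a - η • g)‖ ≤ η * ‖g‖ := by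
    have := lipschitzWith_proj01.dist_le_mul a (a - η • g)
    rwa [proj01_eq_self ha, dist_eq_norm, dist_eq_norm, sub_sub_cancel, norm_smul,
      Real.norm_of_nonneg hη.le, NNReal.coe_one, one_mul] at this
  rw [rectGrad, norm_smul, Real.norm_of_nonneg (by positivity), one_div]
  rwa [inv_mul_le_iff₀ hη]

/-! ### The second moment of the gradient estimate -/

lemma norm_gradient_le {d : ℕ} {f : EuclideanSpace ℝ (Fin d) → ℝ} {L : ℝ≥0}
    (hf : LipschitzWith L f) (a : EuclideanSpace ℝ (Fin d)) : ‖∇ f a‖ ≤ L := by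
  rw [gradient, LinearIsometryEquiv.norm_map]
  exact norm_fderiv_le_of_lipschitz ℝ hf

/-- The mean value inequality for `f - ⟪∇ f a, ·⟫` on the ball of radius `μ` about `a`. -/
lemma abs_symmetric_difference_sub_inner_le {d : ℕ} {f : EuclideanSpace ℝ (Fin d) → ℝ} {L : ℝ≥0}
    (hd : Differentiable ℝ f) (hL : LipschitzWith L (∇ f)) {μ : ℝ} (hμ : 0 < μ)
    (a u : EuclideanSpace ℝ (Fin d)) (hu : ‖u‖ = 1) :
    |(f (a + μ • u) - f (a - μ • u)) / (2 * μ) - inner ℝ (∇ f a) u| ≤ L * μ := by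
  have hmem : ∀ c : ℝ, |c| = μ → a + c • u ∈ Metric.closedBall a μ := fun c hc => by
    rw [Metric.mem_closedBall, dist_eq_norm, add_sub_cancel_left, norm_smul, hu, mul_one,
      Real.norm_eq_abs, hc]
  have hderiv : ∀ x, HasFDerivWithinAt f (InnerProductSpace.toDual ℝ _ (∇ f x))
      (Metric.closedBall a μ) x := fun x =>
    (hd x).hasGradientAt.hasFDerivAt.hasFDerivWithinAt
  have := (convex_closedBall a μ).norm_image_sub_le_of_norm_hasFDerivWithin_le'
    (fun x _ => hderiv x) (φ := InnerProductSpace.toDual ℝ _ (∇ f a)) (C := L * μ)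
    (fun x hx => by
      rw [← map_sub, LinearIsometryEquiv.norm_map, ← dist_eq_norm]
      exact (hL.dist_le_mul x a).trans
        (mul_le_mul_of_nonneg_left (Metric.mem_closedBall.1 hx) L.2))
    (hmem (-μ) (by rw [abs_neg, abs_of_pos hμ])) (hmem μ (abs_of_pos hμ))
  rw [neg_smul, ← sub_eq_add_neg, add_sub_sub_cancel, ← two_smul ℝ, smul_smul, norm_smul, hu,
    mul_one, map_smul, InnerProductSpace.toDual_apply_apply, Real.norm_eq_abs, Real.norm_eq_abs,
    abs_of_pos (by positivity : 0 < 2 * μ), smul_eq_mul] at this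
  rw [div_sub' (by positivity), abs_div, abs_of_pos (by positivity : 0 < 2 * μ),
    div_le_iff₀ (by positivity)]
  exact this

/-- The estimate splits into the average of the exact directional derivatives and a bias, and the
bias is bounded deterministically. -/
lemma norm_gradEst_sq_le {d q : ℕ} [NeZero q] {f : EuclideanSpace ℝ (Fin d) → ℝ} {L : ℝ≥0}
    (hd : Differentiable ℝ f) (hL : LipschitzWith L (∇ f)) {μ : ℝ} (hμ : 0 < μ)
    (a : EuclideanSpace ℝ (Fin d)) (u : Fin q → UnitSphere d) :
    ‖gradEst f μ u a‖ ^ 2 ≤ 2 * ‖((d : ℝ) / q) •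
        ∑ j, inner ℝ (∇ f a) (u j : EuclideanSpace ℝ (Fin d)) •
          (u j : EuclideanSpace ℝ (Fin d))‖ ^ 2 + 2 * (d * L * μ) ^ 2 := by
  have hq : (0 : ℝ) < q := Nat.cast_pos.2 (NeZero.pos q)
  set X := ((d : ℝ) / q) • ∑ j, inner ℝ (∇ f a) (u j : EuclideanSpace ℝ (Fin d)) •
          (u j : EuclideanSpace ℝ (Fin d)) with hX
  have hY : ‖gradEst f μ u a - X‖ ≤ d * L * μ := by
    rw [hX, gradEst, ← smul_sub, ← Finset.sum_sub_distrib, norm_smul,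
      Real.norm_of_nonneg (by positivity)]
    have : ∀ j ∈ Finset.univ, ‖((f (a + μ • (u j : EuclideanSpace ℝ (Fin d))) -
          f (a - μ • (u j : EuclideanSpace ℝ (Fin d)))) / (2 * μ)) •
        (u j : EuclideanSpace ℝ (Fin d)) - inner ℝ (∇ f a) (u j : EuclideanSpace ℝ (Fin d)) •
          (u j : EuclideanSpace ℝ (Fin d))‖ ≤ L * μ := fun j _ => by
      have hu : ‖(u j : EuclideanSpace ℝ (Fin d))‖ = 1 := norm_eq_of_mem_sphere (u j)
      rw [← sub_smul, norm_smul, hu, mul_one]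
      exact abs_symmetric_difference_sub_inner_le hd hL hμ a _ hu
    refine (mul_le_mul_of_nonneg_left (norm_sum_le_of_le _ this) (by positivity)).trans_eq ?_
    rw [Finset.sum_const, Finset.card_univ, Fintype.card_fin, nsmul_eq_mul]
    field_simp
  have htri : ‖gradEst f μ u a‖ ≤ ‖X‖ + d * L * μ := by
    linarith [norm_le_norm_add_norm_sub' (gradEst f μ u a) X]
  calc ‖gradEst f μ u a‖ ^ 2 ≤ (‖X‖ + d * L * μ) ^ 2 := by gcongr
    _ ≤ _ := by linarith [sq_nonneg (‖X‖ - d * L * μ)]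

lemma continuous_gradEst {d q : ℕ} {f : EuclideanSpace ℝ (Fin d) → ℝ} (hf : Continuous f) (μ : ℝ) :
    Continuous fun p : EuclideanSpace ℝ (Fin d) × (Fin q → UnitSphere d) =>
      gradEst f μ p.2 p.1 := by
  unfold gradEst; fun_prop

/-- A bound uniform in the directions, used only for integrability. -/
lemma norm_gradEst_le {d q : ℕ} [NeZero q] {f : EuclideanSpace ℝ (Fin d) → ℝ} {L : ℝ≥0}
    (hf : LipschitzWith L f) {μ : ℝ} (hμ : 0 < μ)
    (a : EuclideanSpace ℝ (Fin d)) (u : Fin q → UnitSphere d) : ‖gradEst f μ u a‖ ≤ d * L := by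
  have hq : (0 : ℝ) < q := Nat.cast_pos.2 (NeZero.pos q)
  rw [gradEst, norm_smul, Real.norm_of_nonneg (by positivity)]
  have : ∀ j ∈ Finset.univ, ‖((f (a + μ • (u j : EuclideanSpace ℝ (Fin d))) -
      f (a - μ • (u j : EuclideanSpace ℝ (Fin d)))) / (2 * μ)) •
        (u j : EuclideanSpace ℝ (Fin d))‖ ≤ L := fun j _ => by
    have hu : ‖(u j : EuclideanSpace ℝ (Fin d))‖ = 1 := norm_eq_of_mem_sphere (u j)
    rw [norm_smul, hu, mul_one, norm_div, Real.norm_of_nonneg (by positivity : 0 ≤ 2 * μ),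
      div_le_iff₀ (by positivity)]
    have := hf.dist_le_mul (a + μ • (u j : EuclideanSpace ℝ (Fin d)))
      (a - μ • (u j : EuclideanSpace ℝ (Fin d)))
    rwa [dist_eq_norm, dist_eq_norm, add_sub_sub_cancel, ← two_smul ℝ, smul_smul, norm_smul, hu,
      mul_one, Real.norm_of_nonneg (by positivity : 0 ≤ 2 * μ)] at this
  refine (mul_le_mul_of_nonneg_left (norm_sum_le_of_le _ this) (by positivity)).trans_eq ?_
  rw [Finset.sum_const, Finset.card_univ, Fintype.card_fin, nsmul_eq_mul]
  field_simp

lemma integral_norm_gradEst_sq_le {d q : ℕ} [NeZero d] [NeZero q]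
    {f : EuclideanSpace ℝ (Fin d) → ℝ} {L₁ L₂ : ℝ≥0} (hf : LipschitzWith L₁ f)
    (hd : Differentiable ℝ f) (hL : LipschitzWith L₂ (∇ f)) {μ cμ : ℝ} (hμ : 0 < μ)
    (hμc : μ ≤ cμ / Real.sqrt (d * q)) (a : EuclideanSpace ℝ (Fin d)) :
    ∫ u, ‖gradEst f μ u a‖ ^ 2 ∂Measure.pi (fun _ : Fin q => uniformSphere d) ≤
      2 * ((L₁ : ℝ) ^ 2 + L₂ ^ 2 * cμ ^ 2) * (((d : ℝ) + q) / q) := by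
  have hq0 : (0 : ℝ) < q := Nat.cast_pos.2 (NeZero.pos q)
  have hd0 : (0 : ℝ) < d := Nat.cast_pos.2 (NeZero.pos d)
  have hcont := continuous_gradEst (q := q) hf.continuous μ
  have hμ2 : μ ^ 2 ≤ cμ ^ 2 / (d * q) := by
    have := pow_le_pow_left₀ hμ.le hμc 2
    rwa [div_pow, Real.sq_sqrt (by positivity)] at this
  have hbias : ((d : ℝ) * L₂ * μ) ^ 2 ≤ L₂ ^ 2 * cμ ^ 2 * (((d : ℝ) + q) / q) := by
    calc ((d : ℝ) * L₂ * μ) ^ 2 = (d : ℝ) ^ 2 * L₂ ^ 2 * μ ^ 2 := by ring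
      _ ≤ (d : ℝ) ^ 2 * L₂ ^ 2 * (cμ ^ 2 / (d * q)) := by gcongr
      _ = L₂ ^ 2 * cμ ^ 2 * ((d : ℝ) / q) := by field_simp
      _ ≤ _ := by gcongr; linarith
  have hmain : ‖∇ f a‖ ^ 2 * (((d : ℝ) + q - 1) / q) ≤ (L₁ : ℝ) ^ 2 * (((d : ℝ) + q) / q) := by
    calc ‖∇ f a‖ ^ 2 * (((d : ℝ) + q - 1) / q) ≤ ‖∇ f a‖ ^ 2 * (((d : ℝ) + q) / q) := by
          gcongr; linarith
      _ ≤ _ := by gcongr; exact norm_gradient_le hf a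
  have hI : Integrable (fun u : Fin q → UnitSphere d => 2 * ‖((d : ℝ) / q) •
        ∑ j, inner ℝ (∇ f a) (u j : EuclideanSpace ℝ (Fin d)) •
          (u j : EuclideanSpace ℝ (Fin d))‖ ^ 2)
      (Measure.pi (fun _ : Fin q => uniformSphere d)) :=
    integrable_of_continuous_of_compactSpace (by fun_prop)
  have h := integral_mono (μ := Measure.pi (fun _ : Fin q => uniformSphere d))
    (integrable_of_continuous_of_compactSpace
      ((hcont.comp (Continuous.prodMk_right a)).norm.pow 2))
    (hI.add (integrable_const _)) (fun u => norm_gradEst_sq_le hd hL hμ a u)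
  refine h.trans ?_
  simp only [Pi.add_apply]
  rw [integral_add hI (integrable_const _), integral_const_mul, integral_norm_sq_sum_inner_smul]
  simp only [integral_const, probReal_univ, one_smul]
  linarith

/-! ### Dependence of the iterates on the directions -/

section Iterates

variable {d q : ℕ} {f : EuclideanSpace ℝ (Fin d) → ℝ} {μ : ℝ} {η : ℕ → ℝ}
  {a₀ : EuclideanSpace ℝ (Fin d)}

lemma zoIterate_mem_unitCube (ha₀ : a₀ ∈ unitCube d) (u : ℕ → Fin q → UnitSphere d) :
    ∀ t, zoIterate f μ η a₀ u t ∈ unitCube d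
  | 0 => ha₀
  | _ + 1 => proj01_mem_unitCube _

lemma zoIterate_congr {u v : ℕ → Fin q → UnitSphere d} :
    ∀ {t : ℕ}, (∀ s < t, u s = v s) → zoIterate f μ η a₀ u t = zoIterate f μ η a₀ v t
  | 0, _ => rfl
  | t + 1, h => by
    rw [zoIterate, zoIterate, zoIterate_congr fun s hs => h s (hs.trans t.lt_succ_self),
      h t t.lt_succ_self]

lemma zoRectGrad_congr {u v : ℕ → Fin q → UnitSphere d} {t : ℕ} (h : ∀ s ≤ t, u s = v s) :
    zoRectGrad f μ η a₀ u t = zoRectGrad f μ η a₀ v t := by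
  rw [zoRectGrad, zoRectGrad, zoIterate_congr fun s hs => h s hs.le, h t le_rfl]

lemma continuous_zoIterate {X : Type*} [TopologicalSpace X] (hf : Continuous f)
    {u : X → ℕ → Fin q → UnitSphere d} (hu : ∀ s j, Continuous fun x => u x s j) :
    ∀ t, Continuous fun x => zoIterate f μ η a₀ (u x) t
  | 0 => continuous_const
  | t + 1 => by
    have h := continuous_zoIterate hf hu t
    exact lipschitzWith_proj01.continuous.comp (h.sub (((continuous_gradEst hf μ).comp
      (h.prodMk (continuous_pi (hu t)))).const_smul (η t)))

lemma continuous_zoRectGrad {X : Type*} [TopologicalSpace X] (hf : Continuous f)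
    {u : X → ℕ → Fin q → UnitSphere d} (hu : ∀ s j, Continuous fun x => u x s j) (t : ℕ) :
    Continuous fun x => zoRectGrad f μ η a₀ (u x) t := by
  have h := continuous_zoIterate (μ := μ) (η := η) (a₀ := a₀) hf hu t
  exact (h.sub (lipschitzWith_proj01.continuous.comp (h.sub (((continuous_gradEst hf μ).comp
    (h.prodMk (continuous_pi (hu t)))).const_smul (η t))))).const_smul (1 / η t)

lemma norm_zoRectGrad_le (ha₀ : a₀ ∈ unitCube d) (u : ℕ → Fin q → UnitSphere d) {t : ℕ}
    (hη : 0 < η t) : ‖zoRectGrad f μ η a₀ u t‖ ≤ ‖gradEst f μ (u t) (zoIterate f μ η a₀ u t)‖ :=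
  norm_rectGrad_le (zoIterate_mem_unitCube ha₀ u t) _ hη

/-- Directions indexed by a set of pairs (iteration below `T`, sample), extended by `s₀` to
all pairs. This turns functions of an infinite family of directions into functions of finitely
many of them. -/
def extendDirections {T : ℕ} (S : Finset (Fin T × Fin q)) (s₀ : UnitSphere d)
    (v : S → UnitSphere d) (n : ℕ) (j : Fin q) : UnitSphere d :=
  if h : ∃ hn : n < T, ((⟨n, hn⟩, j) : Fin T × Fin q) ∈ S then v ⟨(⟨n, h.1⟩, j), h.2⟩ else s₀

lemma continuous_extendDirections {T : ℕ} (S : Finset (Fin T × Fin q)) (s₀ : UnitSphere d)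
    (n : ℕ) (j : Fin q) : Continuous fun v => extendDirections S s₀ v n j := by
  unfold extendDirections
  split_ifs <;> fun_prop

lemma continuous_extendDirections_univ {T : ℕ} (s₀ : UnitSphere d) (n : ℕ) (j : Fin q) :
    Continuous fun v : Fin T × Fin q → UnitSphere d =>
      extendDirections Finset.univ s₀ (fun p => v p.1) n j :=
  have hrestrict : Continuous fun (v : Fin T × Fin q → UnitSphere d)
      (p : (Finset.univ : Finset (Fin T × Fin q))) => v p.1 := by fun_prop
  (continuous_extendDirections Finset.univ s₀ n j).comp hrestrict

lemma extendDirections_apply {T : ℕ} {S : Finset (Fin T × Fin q)} {s₀ : UnitSphere d}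
    {u : ℕ → Fin q → UnitSphere d} {n : ℕ} (hn : n < T)
    (h : ∀ j, ((⟨n, hn⟩, j) : Fin T × Fin q) ∈ S) :
    extendDirections S s₀ (fun p => u p.1.1 p.1.2) n = u n := by
  funext j
  rw [extendDirections, dif_pos ⟨hn, h j⟩]

variable {Ω : Type*} [MeasurableSpace Ω] {P : Measure Ω} {T : ℕ} {u : ℕ → Fin q → Ω → UnitSphere d}

/-- The iterate `a_t` is a function of the directions of the iterations before `t`. -/
lemma indepFun_zoIterate (hf : Continuous f) (s₀ : UnitSphere d)
    (hu : ∀ p : Fin T × Fin q, AEMeasurable (u p.1 p.2) P)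
    (hind : iIndepFun (fun (p : Fin T × Fin q) => u p.1 p.2) P) (t : Fin T) :
    IndepFun (fun ω => zoIterate f μ η a₀ (fun s j => u s j ω) t) (fun ω j => u t j ω) P := by
  classical
  let S : Finset (Fin T × Fin q) := Finset.univ.filter fun p => p.1 < t
  let S' : Finset (Fin T × Fin q) := Finset.univ.filter fun p => p.1 = t
  have hdisj : Disjoint S S' := Finset.disjoint_filter.2 fun p _ h h' => h.ne h'
  have hmeas : Measurable fun v : S → UnitSphere d =>
      zoIterate f μ η a₀ (extendDirections S s₀ v) t :=
    (continuous_zoIterate hf (fun n j => continuous_extendDirections S s₀ n j) t).measurable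
  have hmeas' : Measurable fun (v : S' → UnitSphere d) (j : Fin q) =>
      v ⟨(t, j), Finset.mem_filter.2 ⟨Finset.mem_univ _, rfl⟩⟩ := by fun_prop
  have h := (hind.indepFun_finset₀ S S' hdisj hu).comp hmeas hmeas'
  have heq : (fun ω => zoIterate f μ η a₀ (fun s j => u s j ω) t) =
      (fun v => zoIterate f μ η a₀ (extendDirections S s₀ v) t) ∘
        fun ω (p : S) => u p.1.1 p.1.2 ω := by
    funext ω
    refine zoIterate_congr fun s hs => ?_
    exact (extendDirections_apply (u := fun s j => u s j ω) (hs.trans t.2) fun j =>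
      Finset.mem_filter.2 ⟨Finset.mem_univ _, hs⟩).symm
  rw [heq]
  exact h

lemma aemeasurable_directions (hu : ∀ p : Fin T × Fin q, AEMeasurable (u p.1 p.2) P) :
    AEMeasurable (fun ω (p : Fin T × Fin q) => u p.1 p.2 ω) P :=
  aemeasurable_pi_lambda _ hu

lemma aemeasurable_zoIterate (hf : Continuous f) (s₀ : UnitSphere d)
    (hu : ∀ p : Fin T × Fin q, AEMeasurable (u p.1 p.2) P) (t : Fin T) :
    AEMeasurable (fun ω => zoIterate f μ η a₀ (fun s j => u s j ω) t) P := by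
  have hmeas : Measurable fun v : Fin T × Fin q → UnitSphere d =>
      zoIterate f μ η a₀ (extendDirections Finset.univ s₀ fun p => v p.1) t :=
    (continuous_zoIterate hf (continuous_extendDirections_univ s₀) t).measurable
  convert hmeas.comp_aemeasurable (aemeasurable_directions hu) using 1
  funext ω
  refine zoIterate_congr fun s hs => ?_
  exact (extendDirections_apply (u := fun s j => u s j ω) (hs.trans t.2) (by simp)).symm

/-- Conditionally on the past, the directions of iteration `t` are independent and uniform, so the
bound at a fixed point applies to the random iterate. -/
lemma integral_norm_gradEst_zoIterate_sq_le [NeZero d] [NeZero q] [IsProbabilityMeasure P]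
    {L₁ L₂ : ℝ≥0} (hf : LipschitzWith L₁ f) (hd : Differentiable ℝ f)
    (hL : LipschitzWith L₂ (∇ f)) {cμ : ℝ} (hμ : 0 < μ) (hμc : μ ≤ cμ / Real.sqrt (d * q))
    (s₀ : UnitSphere d) (hu : ∀ t < T, ∀ j, HasLaw (u t j) (uniformSphere d) P)
    (hind : iIndepFun (fun (p : Fin T × Fin q) => u p.1 p.2) P) (t : Fin T) :
    Integrable (fun ω =>
        ‖gradEst f μ (fun j => u t j ω) (zoIterate f μ η a₀ (fun s j => u s j ω) t)‖ ^ 2) P ∧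
      ∫ ω, ‖gradEst f μ (fun j => u t j ω) (zoIterate f μ η a₀ (fun s j => u s j ω) t)‖ ^ 2 ∂P ≤
        2 * ((L₁ : ℝ) ^ 2 + L₂ ^ 2 * cμ ^ 2) * (((d : ℝ) + q) / q) := by
  have hu' : ∀ p : Fin T × Fin q, AEMeasurable (u p.1 p.2) P := fun p => (hu _ p.1.2 _).aemeasurable
  have hA : AEMeasurable (fun ω => zoIterate f μ η a₀ (fun s j => u s j ω) t) P :=
    aemeasurable_zoIterate hf.continuous s₀ hu' t
  have hV : AEMeasurable (fun ω j => u t j ω) P := aemeasurable_pi_lambda _ fun j => hu' (t, j)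
  have hlawV : P.map (fun ω j => u t j ω) = Measure.pi fun _ => uniformSphere d := by
    have := iIndepFun.map_fun_eq_pi_map (fun j => hu' (t, j))
      (hind.precomp (g := fun j : Fin q => (t, j)) fun _ _ h => (Prod.ext_iff.1 h).2)
    simpa only [(hu t t.2 _).map_eq] using this
  have hlaw := (indepFun_zoIterate (μ := μ) (η := η) (a₀ := a₀) hf.continuous s₀ hu'
    hind t).map_prod_eq_prod_map_map hA hV
  rw [hlawV] at hlaw
  have : IsProbabilityMeasure (P.map fun ω => zoIterate f μ η a₀ (fun s j => u s j ω) t) :=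
    Measure.isProbabilityMeasure_map hA
  have hc : Continuous fun p : EuclideanSpace ℝ (Fin d) × (Fin q → UnitSphere d) =>
      ‖gradEst f μ p.2 p.1‖ ^ 2 := (continuous_gradEst hf.continuous μ).norm.pow 2
  have hb : ∀ (a : EuclideanSpace ℝ (Fin d)) (v : Fin q → UnitSphere d),
      ‖‖gradEst f μ v a‖ ^ 2‖ ≤ (d * L₁ : ℝ) ^ 2 := fun a v => by
    rw [Real.norm_of_nonneg (by positivity)]
    exact pow_le_pow_left₀ (norm_nonneg _) (norm_gradEst_le hf hμ a v) 2
  refine ⟨Integrable.of_bound (hc.measurable.comp_aemeasurable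
    (hA.prodMk hV)).aestronglyMeasurable _ (ae_of_all _ fun ω => hb _ _), ?_⟩
  have h1 := integral_map (hA.prodMk hV) hc.aestronglyMeasurable
  rw [← h1, hlaw, integral_prod _ (Integrable.of_bound hc.aestronglyMeasurable _
    (ae_of_all _ fun p => hb p.1 p.2))]
  refine (integral_mono_of_nonneg (ae_of_all _ fun a => integral_nonneg fun v => by positivity)
    (integrable_const _) (ae_of_all _ fun a =>
      integral_norm_gradEst_sq_le hf hd hL hμ hμc a)).trans_eq ?_
  simp

end Iterates

/-! ### The random iterate -/

/-- Evaluating a family of functions of `U` at an independent random index averages their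
expectations, with the law of the index as weights. -/
lemma integral_comp_random_index {Ω 𝓤 ι : Type*} [MeasurableSpace Ω] [MeasurableSpace 𝓤]
    [Fintype ι] [MeasurableSpace ι] [MeasurableSingletonClass ι] {P : Measure Ω}
    [IsProbabilityMeasure P] {r : Ω → ι} {U : Ω → 𝓤} (hr : Measurable r) (hU : AEMeasurable U P)
    (hrU : IndepFun r U P) {F : ι → 𝓤 → ℝ} (hF : ∀ i, Measurable (F i))
    (hint : ∀ i, Integrable (fun ω => F i (U ω)) P) :
    Integrable (fun ω => F (r ω) (U ω)) P ∧
      ∫ ω, F (r ω) (U ω) ∂P = ∑ i, P.real {ω | r ω = i} * ∫ ω, F i (U ω) ∂P := by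
  classical
  have hsing : ∀ i, MeasurableSet {ω | r ω = i} := fun i => hr (measurableSet_singleton i)
  have hsum : (fun ω => F (r ω) (U ω)) =
      fun ω => ∑ i, Set.indicator {ω | r ω = i} (fun ω => F i (U ω)) ω := by
    funext ω
    simp [Set.indicator_apply]
  have hind : ∀ i, Integrable (Set.indicator {ω | r ω = i} fun ω => F i (U ω)) P := fun i =>
    (hint i).indicator (hsing i)
  rw [hsum]
  refine ⟨integrable_finsetSum _ fun i _ => hind i, ?_⟩
  rw [integral_finsetSum _ fun i _ => hind i]
  refine Finset.sum_congr rfl fun i _ => ?_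
  have hmul := hrU.integral_fun_comp_mul_comp (f := Set.indicator {i} fun _ => (1 : ℝ)) (g := F i)
    hr.aemeasurable hU
    ((measurable_const.indicator (measurableSet_singleton i)).aestronglyMeasurable)
    (hF i).aestronglyMeasurable
  have hone : ∫ ω, Set.indicator {i} (fun _ => (1 : ℝ)) (r ω) ∂P = P.real {ω | r ω = i} :=
    (integral_indicator_one (hsing i))
  rw [← hone, ← hmul]
  refine integral_congr_ae (ae_of_all _ fun ω => ?_)
  simp [Set.indicator_apply]

theorem theorem2 (L₁ L₂ : ℝ≥0) (hL₁ : 0 < L₁) (hL₂ : 0 < L₂)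
    (cη cμ : ℝ) (hcη : 0 < cη) (hcμ : 0 < cμ) :
    ∃ C : ℝ, 0 < C ∧
      ∀ (d q T : ℕ), 1 ≤ d → 1 ≤ q → 1 ≤ T →
      -- the loss, with its Lipschitz and smoothness assumptions
      ∀ f : EuclideanSpace ℝ (Fin d) → ℝ,
        LipschitzWith L₁ f → Differentiable ℝ f → LipschitzWith L₂ (∇ f) →
      -- starting point, step sizes of order `1/√T`, smoothing radius of order `1/√(dq)`
      ∀ a₀ ∈ unitCube d,
      ∀ η : ℕ → ℝ, (∀ t < T, 0 < η t ∧ η t ≤ cη / Real.sqrt T) →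
      ∀ μ : ℝ, 0 < μ → μ ≤ cμ / Real.sqrt (d * q) →
      ∀ (Ω : Type*) [MeasurableSpace Ω] (P : Measure Ω) [IsProbabilityMeasure P],
      -- independent directions, uniform on the sphere: `q` of them in each of the `T` iterations
      ∀ u : ℕ → Fin q → Ω → UnitSphere d,
        (∀ t < T, ∀ j, HasLaw (u t j) (uniformSphere d) P) →
        iIndepFun (fun (p : Fin T × Fin q) => u p.1 p.2) P →
      -- the random index, independent of the directions, with `P(r = t)` as prescribed
      ∀ r : Ω → Fin T, Measurable r →
        IndepFun r (fun ω (p : Fin T × Fin q) => u p.1 p.2 ω) P →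
        (∀ t : Fin T, P.real {ω | r ω = t} =
          stepWeight L₂ (η t) / ∑ s : Fin T, stepWeight L₂ (η s)) →
      -- the rectified gradient at the random iterate `a_r`
      Integrable (fun ω => ‖zoRectGrad f μ η a₀ (fun t j => u t j ω) (r ω)‖ ^ 2) P ∧
        ∫ ω, ‖zoRectGrad f μ η a₀ (fun t j => u t j ω) (r ω)‖ ^ 2 ∂P ≤
          C * (1 / Real.sqrt T + ((d : ℝ) + q) / q) := by
  refine ⟨2 * ((L₁ : ℝ) ^ 2 + L₂ ^ 2 * cμ ^ 2), by positivity, ?_⟩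
  intro d q T hd1 hq1 hT f hf hd hL a₀ ha₀ η hη μ hμ hμc Ω _ P _ u hu hind r hr hrU _
  have : NeZero d := ⟨by omega⟩
  have : NeZero q := ⟨by omega⟩
  obtain ⟨ω₀⟩ := P.nonempty_of_neZero
  let s₀ : UnitSphere d := u 0 0 ω₀
  have hu' : ∀ p : Fin T × Fin q, AEMeasurable (u p.1 p.2) P := fun p => (hu _ p.1.2 _).aemeasurable
  let F : Fin T → (Fin T × Fin q → UnitSphere d) → ℝ := fun t v =>
    ‖zoRectGrad f μ η a₀ (extendDirections Finset.univ s₀ fun p => v p.1) t‖ ^ 2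
  have hF : ∀ t, Continuous (F t) := fun t =>
    (continuous_zoRectGrad hf.continuous (continuous_extendDirections_univ s₀) t).norm.pow 2
  have hFu : ∀ ω t, F t (fun p => u p.1 p.2 ω) =
      ‖zoRectGrad f μ η a₀ (fun t j => u t j ω) t‖ ^ 2 := fun ω t => by
    refine congrArg (fun g => ‖g‖ ^ 2) (zoRectGrad_congr fun s hs => ?_)
    exact extendDirections_apply (u := fun s j => u s j ω) (hs.trans_lt t.2) (by simp)
  have hG := integral_norm_gradEst_zoIterate_sq_le (η := η) (a₀ := a₀) hf hd hL hμ hμc s₀ hu hind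
  have hle : ∀ t ω, F t (fun p => u p.1 p.2 ω) ≤ ‖gradEst f μ (fun j => u t j ω)
      (zoIterate f μ η a₀ (fun s j => u s j ω) t)‖ ^ 2 := fun t ω => by
    rw [hFu]
    exact pow_le_pow_left₀ (norm_nonneg _) (norm_zoRectGrad_le ha₀ _ (hη t t.2).1) 2
  have hU := aemeasurable_directions hu'
  have hint : ∀ t, Integrable (fun ω => F t fun p => u p.1 p.2 ω) P := fun t =>
    (hG t).1.mono' ((hF t).measurable.comp_aemeasurable hU).aestronglyMeasurable
      (ae_of_all _ fun ω => by
        rw [Real.norm_of_nonneg (by positivity)]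
        exact hle t ω)
  have hmain := integral_comp_random_index hr hU hrU (fun t => (hF t).measurable) hint
  simp only [hFu] at hmain
  refine ⟨hmain.1, ?_⟩
  -- the weights are those of a probability law, so they sum to one
  have hone : ∑ t, P.real {ω | r ω = t} = 1 := by
    have := (integral_comp_random_index hr hU hrU (F := fun _ _ => 1)
      (fun _ => measurable_const) fun _ => integrable_const _).2
    simpa using this.symm
  rw [hmain.2]
  calc ∑ t, P.real {ω | r ω = t} * ∫ ω, ‖zoRectGrad f μ η a₀ (fun t j => u t j ω) t‖ ^ 2 ∂P
      ≤ ∑ t, P.real {ω | r ω = t} *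
          (2 * ((L₁ : ℝ) ^ 2 + L₂ ^ 2 * cμ ^ 2) * (((d : ℝ) + q) / q)) := by
        refine Finset.sum_le_sum fun t _ => mul_le_mul_of_nonneg_left ?_ measureReal_nonneg
        simp only [← hFu]
        exact (integral_mono (hint t) (hG t).1 (hle t)).trans (hG t).2
    _ = 2 * ((L₁ : ℝ) ^ 2 + L₂ ^ 2 * cμ ^ 2) * (((d : ℝ) + q) / q) := by
        rw [← Finset.sum_mul, hone, one_mul]
    _ ≤ _ := by
        gcongr
        linarith [show 0 ≤ 1 / Real.sqrt T by positivity]
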